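/- Let $P$ be a probability distribution on $\mathbb{R}^p\times\mathbb{R}$ such that, for $(x,y)\sim P$, $y$ is integrable and, with $f(x)=\mathbb{E}(y\mid x)$, the error $\epsilon=y-f(x)$ is independent of $x$ and the conditional variance $\mathrm{Var}(y\mid x)=\sigma^2<\infty$ is constant; $f$ is not assumed to be linear. Let $Q$ be the distribution of $x$. Let $(x_1,y_1),\dots,(x_n,y_n)$ be i.i.d. from $P$, let $(x_0,y_0)\sim P$ be independent of them, let $X\in\mathbb{R}^{n\times p}$ be the matrix with rows $x_i$ and $Y=(y_1,\dots,y_n)$. Let $\hat f_n(x)=x^T\hat\beta$ be the least squares regression predictor (without intercept), where $\hat\beta$ minimizes $\|Y-X\beta\|_2^2$ over $\beta\in\mathbb{R}^p$. Define the excess variance $$V^+=\mathbb{E}_{X,x_0}\mathrm{Var}\big(\hat f_n(x_0)\mid X,x_0\big)-\mathbb{E}_X\mathrm{Var}\big(\hat f_n(x_1)\mid X\big).$$ Assume that $Q=N(0,\Sigma)$, where $\Sigma\in\mathbb{R}^{p\times p}$ is invertible, and that $p<n-1$. Then both expectations are finite and $$V^+=\frac{\sigma^2p}{n}\,\frac{p+1}{n-p-1}.$$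 In particular, $V^+$ depends neither on $\Sigma$ nor on the form of $f$. -/

import Mathlib

open MeasureTheory ProbabilityTheory
open scoped ENNReal

/-- The regression model `y = f(x) + ε` for a pair `(x, y) ∼ P` with `x ∈ ℝᵖ`, `y ∈ ℝ`:
`f(x) = 𝔼(y | x)`, the error `ε = y - f(x)` is independent of `x`, and the conditional variance of
`y` given `x` is the (finite) constant `σ²`. -/
structure IsRegressionModel {p : ℕ} (P : Measure (EuclideanSpace ℝ (Fin p) × ℝ))
    [IsProbabilityMeasure P] (f : EuclideanSpace ℝ (Fin p) → ℝ) (σ : ℝ) : Prop where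
  measurable_f : Measurable f
  integrable_y : Integrable (fun z : EuclideanSpace ℝ (Fin p) × ℝ => z.2) P
  condExp_eq : P[fun z : EuclideanSpace ℝ (Fin p) × ℝ => z.2 |
      MeasurableSpace.comap Prod.fst inferInstance] =ᵐ[P] fun z => f z.1
  indep_error : IndepFun (fun z : EuclideanSpace ℝ (Fin p) × ℝ => z.2 - f z.1) Prod.fst P
  condVar_eq : ∀ᵐ z ∂P, eVar[id; condDistrib Prod.snd Prod.fst P z.1] = ENNReal.ofReal (σ ^ 2)

/-- `fhat` is the least squares regression procedure (without intercept): for all covariate rows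
`X = (x₁, …, xₙ)` and responses `Y = (y₁, …, yₙ)`, the prediction function `fhat X Y` is
`x ↦ ⟪b, x⟫` for some minimizer `b` of the residual sum of squares. The minimizer is unique when the
matrix with rows `xᵢ` has full column rank. -/
def IsLeastSquares {n p : ℕ}
    (fhat : (Fin n → EuclideanSpace ℝ (Fin p)) → (Fin n → ℝ) → EuclideanSpace ℝ (Fin p) → ℝ) :
    Prop :=
  ∀ X Y, ∃ b : EuclideanSpace ℝ (Fin p),
    (∀ c : EuclideanSpace ℝ (Fin p),
      ∑ i, (Y i - inner ℝ b (X i)) ^ 2 ≤ ∑ i, (Y i - inner ℝ c (X i)) ^ 2) ∧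
    ∀ x, fhat X Y x = inner ℝ b x

/-- The integrated conditional variance `𝔼_W Var(Z | W) ∈ [0, ∞]`, where `Var(Z | W)` is the
variance of the (regular) conditional distribution of `Z` given `W`. -/
noncomputable def integratedCondVar {Ω β : Type*} [MeasurableSpace Ω] [MeasurableSpace β]
    (μ : Measure Ω) [IsFiniteMeasure μ] (Z : Ω → ℝ) (W : Ω → β) : ℝ≥0∞ :=
  ∫⁻ ω, eVar[id; condDistrib Z W μ (W ω)] ∂μ

/-- The Random-X integrated variance `𝔼_{X,x₀} Var(f̂ₙ(x₀) | X, x₀)` (equal to `V + V⁺`). -/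
noncomputable def randomXVariance {Ω : Type*} [MeasurableSpace Ω] {n p : ℕ}
    (μ : Measure Ω) [IsFiniteMeasure μ]
    (fhat : (Fin n → EuclideanSpace ℝ (Fin p)) → (Fin n → ℝ) → EuclideanSpace ℝ (Fin p) → ℝ)
    (x : Fin n → Ω → EuclideanSpace ℝ (Fin p)) (y : Fin n → Ω → ℝ)
    (x₀ : Ω → EuclideanSpace ℝ (Fin p)) : ℝ≥0∞ :=
  integratedCondVar μ (fun ω => fhat (fun i => x i ω) (fun i => y i ω) (x₀ ω))
    (fun ω => ((fun i => x i ω), x₀ ω))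

/-- The Same-X integrated variance `V = 𝔼_X Var(f̂ₙ(x₁) | X)`, with `x₁` the first of the `n`
training covariates. -/
noncomputable def sameXVariance {Ω : Type*} [MeasurableSpace Ω] {n p : ℕ} (hn : 0 < n)
    (μ : Measure Ω) [IsFiniteMeasure μ]
    (fhat : (Fin n → EuclideanSpace ℝ (Fin p)) → (Fin n → ℝ) → EuclideanSpace ℝ (Fin p) → ℝ)
    (x : Fin n → Ω → EuclideanSpace ℝ (Fin p)) (y : Fin n → Ω → ℝ) : ℝ≥0∞ :=
  integratedCondVar μ (fun ω => fhat (fun i => x i ω) (fun i => y i ω) (x ⟨0, hn⟩ ω))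
    (fun ω => (fun i => x i ω))

/-- The excess variance `V⁺ = 𝔼_{X,x₀} Var(f̂ₙ(x₀) | X, x₀) - 𝔼_X Var(f̂ₙ(x₁) | X)`; meaningful when
both terms are finite. -/
noncomputable def excessVariance {Ω : Type*} [MeasurableSpace Ω] {n p : ℕ} (hn : 0 < n)
    (μ : Measure Ω) [IsFiniteMeasure μ]
    (fhat : (Fin n → EuclideanSpace ℝ (Fin p)) → (Fin n → ℝ) → EuclideanSpace ℝ (Fin p) → ℝ)
    (x : Fin n → Ω → EuclideanSpace ℝ (Fin p)) (y : Fin n → Ω → ℝ)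
    (x₀ : Ω → EuclideanSpace ℝ (Fin p)) : ℝ :=
  (randomXVariance μ fhat x y x₀).toReal - (sameXVariance hn μ fhat x y).toReal

/-! Almost surely `XᵀX` is invertible. Then the minimizer is unique and the prediction at `v` is `w
⬝ᵥ Y` with `w = X(XᵀX)⁻¹v`. Writing `Y = f(X) + ε`, with `ε` independent of the covariates, the
regression function only shifts the prediction by a function of the covariates. The conditional
variance is therefore `σ²‖w‖² = σ² vᵀ(XᵀX)⁻¹v`, which is `σ²` times the `leverage` of `v`. Both
variances reduce to mean leverages.

For `v = x₁`, the leverages of the `n` rows sum to the trace of the hat matrix, which is `p`. By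
exchangeability each has mean `p / n` (`lintegral_leverage_self`).

For an independent `v = x₀`, leverage is invariant under invertible linear maps, so `Σ` may be taken
to be the identity. Averaging over `v` leaves the trace of `(XᵀX)⁻¹`. Its `j`-th diagonal entry is
the inverse squared distance from column `j` to the span of the other `p - 1` columns. The columns
are independent standard Gaussians in `ℝⁿ`, so this squared distance is chi-squared with `n - p + 1`
degrees of freedom, and its inverse has mean `1 / (n - p - 1)` (`lintegral_inv_gram_apply_self`).
Subtracting, `p / (n - p - 1) - p / n = p(p + 1) / (n(n - p - 1))`. -/

/-! ### Inverse moments of chi-squared variables -/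

section InverseNorm

lemma integral_exp_neg_mul_sq_gaussianReal {t : ℝ} (ht : 0 ≤ t) :
    ∫ x, Real.exp (-t * x ^ 2) ∂gaussianReal 0 1 = (√(1 + 2 * t))⁻¹ := by
  rw [integral_gaussianReal_eq_integral_smul one_ne_zero]
  have h : ∀ x : ℝ, gaussianPDFReal 0 1 x • Real.exp (-t * x ^ 2) =
      (√(2 * Real.pi))⁻¹ * Real.exp (-(t + 1 / 2) * x ^ 2) := by
    intro x
    simp only [gaussianPDFReal, smul_eq_mul, NNReal.coe_one, mul_one, sub_zero]
    rw [mul_assoc, ← Real.exp_add]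
    ring_nf
  simp_rw [h]
  rw [integral_const_mul, integral_gaussian, ← Real.sqrt_inv, ← Real.sqrt_inv,
    ← Real.sqrt_mul (by positivity)]
  congr 1
  field_simp
  ring

variable {E : Type*} [NormedAddCommGroup E] [InnerProductSpace ℝ E] [FiniteDimensional ℝ E]
  [MeasurableSpace E] [BorelSpace E]

/-- Coordinates in an orthonormal basis are independent standard normals, so the Laplace transform
of the squared norm factors into one-dimensional ones. -/
lemma integral_exp_neg_mul_norm_sq_stdGaussian {t : ℝ} (ht : 0 ≤ t) :
    ∫ z, Real.exp (-t * ‖z‖ ^ 2) ∂stdGaussian E =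
      (1 + 2 * t) ^ (-(Module.finrank ℝ E : ℝ) / 2) := by
  rw [stdGaussian, integral_map (Measurable.aemeasurable (by fun_prop))
    (Measurable.aestronglyMeasurable (by fun_prop))]
  have h : ∀ x : Fin (Module.finrank ℝ E) → ℝ,
      Real.exp (-t * ‖∑ i, x i • stdOrthonormalBasis ℝ E i‖ ^ 2) =
        ∏ i, Real.exp (-t * x i ^ 2) := by
    intro x
    rw [← Real.exp_sum, ← Finset.mul_sum]
    congr 2
    rw [← (stdOrthonormalBasis ℝ E).sum_sq_norm_inner_right]
    refine Finset.sum_congr rfl fun i _ => ?_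
    rw [(stdOrthonormalBasis ℝ E).orthonormal.inner_right_fintype]
    simp
  simp_rw [h]
  rw [integral_fintype_prod_eq_prod (f := fun _ x => Real.exp (-t * x ^ 2))]
  simp_rw [integral_exp_neg_mul_sq_gaussianReal ht]
  rw [Finset.prod_const, Finset.card_univ, Fintype.card_fin, Real.sqrt_eq_rpow,
    ← Real.rpow_neg (by positivity), ← Real.rpow_natCast, ← Real.rpow_mul (by positivity)]
  ring_nf

/-- This turns an inverse moment into an integral of Laplace transforms. In `[0, ∞]` it also covers
`s = 0`, where both sides are infinite. -/
lemma lintegral_exp_neg_mul_Ioi {s : ℝ} (hs : 0 ≤ s) :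
    ∫⁻ t in Set.Ioi (0 : ℝ), ENNReal.ofReal (Real.exp (-t * s)) = (ENNReal.ofReal s)⁻¹ := by
  rcases hs.eq_or_lt with rfl | hs
  · simp
  · have hint : IntegrableOn (fun t : ℝ => Real.exp (-s * t)) (Set.Ioi 0) :=
      integrableOn_exp_mul_Ioi (by linarith) 0
    have h : ∀ t : ℝ, Real.exp (-t * s) = Real.exp (-s * t) := fun t => by ring_nf
    simp_rw [h]
    rw [← ofReal_integral_eq_lintegral_ofReal hint (ae_of_all _ fun _ => (Real.exp_pos _).le),
      integral_exp_mul_Ioi (by linarith), ← ENNReal.ofReal_inv_of_pos hs]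
    congr 1
    simp [neg_div_neg_eq]

lemma lintegral_one_add_two_mul_rpow_Ioi {a : ℝ} (ha : a < -1) :
    ∫⁻ t in Set.Ioi (0 : ℝ), ENNReal.ofReal ((1 + 2 * t) ^ a) =
      ENNReal.ofReal (1 / (2 * (-a - 1))) := by
  have hd : ∀ t ∈ Set.Ici (0 : ℝ), HasDerivAt (fun t : ℝ => (1 + 2 * t) ^ (a + 1) / (2 * (a + 1)))
      ((1 + 2 * t) ^ a) t := by
    intro t ht
    have ht' : 0 ≤ t := ht
    have h1 : HasDerivAt (fun t : ℝ => 1 + 2 * t) 2 t := by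
      simpa using ((hasDerivAt_id t).const_mul 2).const_add 1
    have h2 := (h1.rpow_const (p := a + 1) (Or.inl (by positivity))).div_const (2 * (a + 1))
    have h3 : a + 1 ≠ 0 := by linarith
    have h4 : 2 * (a + 1) * (1 + 2 * t) ^ (a + 1 - 1) / (2 * (a + 1)) = (1 + 2 * t) ^ a := by
      rw [add_sub_cancel_right]
      field_simp
    exact h4 ▸ h2
  have hlim : Filter.Tendsto (fun t : ℝ => (1 + 2 * t) ^ (a + 1) / (2 * (a + 1))) Filter.atTop
      (nhds (0 / (2 * (a + 1)))) := by
    refine Filter.Tendsto.div_const ?_ _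
    have h1 : Filter.Tendsto (fun t : ℝ => 1 + 2 * t) Filter.atTop Filter.atTop :=
      Filter.tendsto_atTop_add_const_left _ _
        (Filter.tendsto_id.const_mul_atTop (by norm_num))
    have := (tendsto_rpow_neg_atTop (y := -(a + 1)) (by linarith)).comp h1
    simpa [Function.comp_def] using this
  have hnn : ∀ t ∈ Set.Ioi (0 : ℝ), 0 ≤ (1 + 2 * t) ^ a := fun t ht => by
    have : (0 : ℝ) < t := ht
    positivity
  have hint := integrableOn_Ioi_deriv_of_nonneg' hd hnn hlim
  rw [← ofReal_integral_eq_lintegral_ofReal hint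
    ((ae_restrict_iff' measurableSet_Ioi).2 (ae_of_all _ hnn)),
    integral_Ioi_of_hasDerivAt_of_nonneg' hd hnn hlim]
  congr 1
  have h3 : a + 1 ≠ 0 := by linarith
  have h4 : -a - 1 ≠ 0 := by linarith
  simp
  field_simp
  ring

/-- The inverse of a chi-squared variable with `k ≥ 3` degrees of freedom has mean
`1 / (k - 2)`. -/
lemma lintegral_inv_norm_sq_stdGaussian (hE : 3 ≤ Module.finrank ℝ E) :
    ∫⁻ z, (ENNReal.ofReal (‖z‖ ^ 2))⁻¹ ∂stdGaussian E =
      ENNReal.ofReal (1 / ((Module.finrank ℝ E : ℝ) - 2)) := by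
  have hE' : (3 : ℝ) ≤ Module.finrank ℝ E := by exact_mod_cast hE
  -- Write `1 / ‖z‖²` as `∫ exp (-t‖z‖²) dt` and apply Tonelli. The remaining integral of `(1 + 2t)
  -- ^ (-k / 2)` converges because `k ≥ 3`.
  simp_rw [← lintegral_exp_neg_mul_Ioi (sq_nonneg ‖_‖)]
  rw [lintegral_lintegral_swap (Measurable.aemeasurable (by unfold Function.uncurry; fun_prop))]
  have h : ∀ t ∈ Set.Ioi (0 : ℝ), ∫⁻ z, ENNReal.ofReal (Real.exp (-t * ‖z‖ ^ 2)) ∂stdGaussian E =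
      ENNReal.ofReal ((1 + 2 * t) ^ (-(Module.finrank ℝ E : ℝ) / 2)) := by
    intro t ht
    have ht' : (0 : ℝ) < t := ht
    rw [← integral_exp_neg_mul_norm_sq_stdGaussian ht'.le, ofReal_integral_eq_lintegral_ofReal]
    · refine Integrable.of_bound (C := 1) (Measurable.aestronglyMeasurable (by fun_prop))
        (ae_of_all _ fun z => ?_)
      rw [Real.norm_eq_abs, Real.abs_exp, Real.exp_le_one_iff]
      have := sq_nonneg ‖z‖
      nlinarith
    · exact ae_of_all _ fun _ => (Real.exp_pos _).le
  rw [setLIntegral_congr_fun measurableSet_Ioi h, lintegral_one_add_two_mul_rpow_Ioi (by linarith)]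
  congr 2
  ring

/-- For `t ∈ U`, pairing `t` with the projection of `z` is the same as pairing it with `z`, so the
characteristic functions agree. -/
lemma map_orthogonalProjection_stdGaussian (U : Submodule ℝ E) :
    (stdGaussian E).map U.orthogonalProjectionOnto = stdGaussian U := by
  refine Measure.ext_of_charFun ?_
  ext t
  rw [charFun_stdGaussian, charFun_apply, integral_map (Measurable.aemeasurable (by fun_prop))
    (Measurable.aestronglyMeasurable (by fun_prop))]
  have h := charFun_stdGaussian (t : E)
  rw [charFun_apply] at h
  simpa using h

lemma lintegral_inv_norm_sq_orthogonalProjection_stdGaussian (U : Submodule ℝ E)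
    (hU : 3 ≤ Module.finrank ℝ U) :
    ∫⁻ z, (ENNReal.ofReal (‖U.orthogonalProjectionOnto z‖ ^ 2))⁻¹ ∂stdGaussian E =
      ENNReal.ofReal (1 / ((Module.finrank ℝ U : ℝ) - 2)) := by
  rw [← lintegral_inv_norm_sq_stdGaussian hU, ← map_orthogonalProjection_stdGaussian U,
    lintegral_map (by fun_prop) (by fun_prop)]

end InverseNorm

/-! ### Inverse Gram matrices of independent Gaussian vectors -/

section GaussianGram

variable {E : Type*} [NormedAddCommGroup E] [InnerProductSpace ℝ E]

lemma Measurable.matrix_inv_apply {α ι : Type*} [Fintype ι] [DecidableEq ι] [TopologicalSpace α]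
    [MeasurableSpace α] [OpensMeasurableSpace α] {A : α → Matrix ι ι ℝ} (hA : Continuous A)
    (i j : ι) : Measurable fun a => (A a)⁻¹ i j := by
  simp only [Matrix.inv_def, Matrix.smul_apply, smul_eq_mul, Ring.inverse_eq_inv']
  exact hA.matrix_det.measurable.inv.mul (hA.matrix_adjugate.matrix_elem i j).measurable

lemma continuous_gram {ι : Type*} : Continuous fun C : ι → E => Matrix.gram ℝ C :=
  continuous_matrix fun i j => (continuous_apply i).inner (continuous_apply j)

/-- The diagonal entries of an inverse Gram matrix are the inverse squared distances of each vector
to the span of the others. -/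
lemma inv_gram_apply_self [FiniteDimensional ℝ E] {q : ℕ} {C : Fin (q + 1) → E}
    (hC : LinearIndependent ℝ C)
    (j : Fin (q + 1)) :
    (Matrix.gram ℝ C)⁻¹ j j =
      (‖(Submodule.span ℝ (Set.range fun i => C (j.succAbove i)))ᗮ.orthogonalProjectionOnto
        (C j)‖ ^ 2)⁻¹ := by
  set W := Submodule.span ℝ (Set.range fun i => C (j.succAbove i)) with hW
  set A := (Matrix.gram ℝ C)⁻¹ with hA
  have hdet : IsUnit (Matrix.gram ℝ C).det :=
    (Matrix.det_gram_ne_zero_iff_linearIndependent.2 hC).isUnit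
  -- The vector of the dual basis paired with `C j`. It lies in `Wᗮ`, has squared norm `A j j`, and
  -- equals `A j j` times the projection of `C j` to `Wᗮ`. Comparing norms determines `A j j`.
  set w := ∑ i, A i j • C i with hw
  have hCw : ∀ k, inner ℝ (C k) w = if k = j then 1 else 0 := by
    intro k
    have h := congrFun (congrFun (Matrix.mul_nonsing_inv _ hdet) k) j
    rw [Matrix.mul_apply, Matrix.one_apply] at h
    rw [← h, hw, inner_sum]
    refine Finset.sum_congr rfl fun i _ => ?_
    rw [inner_smul_right, Matrix.gram_apply, mul_comm]
  have hww : ‖w‖ ^ 2 = A j j := by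
    rw [← real_inner_self_eq_norm_sq]
    nth_rewrite 1 [hw]
    rw [sum_inner]
    simp [real_inner_smul_left, hCw]
  have hwW : w ∈ Wᗮ := by
    rw [Submodule.mem_orthogonal]
    intro u hu
    induction hu using Submodule.span_induction with
    | mem x hx =>
      obtain ⟨i, rfl⟩ := hx
      simp [hCw]
    | zero => simp
    | add x y _ _ hx hy => rw [inner_add_left, hx, hy, add_zero]
    | smul a x _ hx => rw [inner_smul_left, hx, mul_zero]
  have hPw : Wᗮ.orthogonalProjectionOnto w = A j j • Wᗮ.orthogonalProjectionOnto (C j) := by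
    rw [hw, map_sum, Fin.sum_univ_succAbove _ j]
    rw [map_smul, add_eq_left]
    refine Finset.sum_eq_zero fun i _ => ?_
    rw [map_smul, Submodule.orthogonalProjectionOnto_eq_zero_iff.2, smul_zero]
    exact W.le_orthogonal_orthogonal (Submodule.subset_span ⟨i, rfl⟩)
  have hnorm : A j j = A j j ^ 2 * ‖Wᗮ.orthogonalProjectionOnto (C j)‖ ^ 2 := by
    have h1 : ‖Wᗮ.orthogonalProjectionOnto w‖ = ‖w‖ := by
      simpa using congrArg norm (Submodule.orthogonalProjectionOnto_mem_subspace_eq_self (⟨w, hwW⟩ : Wᗮ))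
    rw [hPw, norm_smul, Real.norm_eq_abs] at h1
    rw [← sq_abs (A j j), ← mul_pow, h1, hww]
  have hne : A j j ≠ 0 := by
    intro h0
    rw [h0] at hww
    have hw0 : w = 0 := by simpa using hww
    have := hCw j
    simp [hw0] at this
  refine eq_inv_of_mul_eq_one_left (mul_left_cancel₀ hne ?_)
  linear_combination -hnorm

variable [FiniteDimensional ℝ E] [MeasurableSpace E] [BorelSpace E]

/-- On `W` the inverse squared distance to `W` is infinite, yet its mean is finite. Codimension
three is what makes that mean finite. -/
lemma ae_notMem_of_finrank_add_three_le (W : Submodule ℝ E)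
    (hW : Module.finrank ℝ W + 3 ≤ Module.finrank ℝ E) : ∀ᵐ z ∂stdGaussian E, z ∉ W := by
  have hU : 3 ≤ Module.finrank ℝ Wᗮ := by
    have := W.finrank_add_finrank_orthogonal
    omega
  have h := lintegral_inv_norm_sq_orthogonalProjection_stdGaussian Wᗮ hU
  have h2 : ∀ᵐ z ∂stdGaussian E,
      (ENNReal.ofReal (‖Wᗮ.orthogonalProjectionOnto z‖ ^ 2))⁻¹ < ∞ :=
    ae_lt_top (by fun_prop) (by rw [h]; exact ENNReal.ofReal_ne_top)
  filter_upwards [h2] with z hz hzW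
  rw [Submodule.orthogonalProjectionOnto_eq_zero_iff.2 (W.le_orthogonal_orthogonal hzW)] at hz
  simp at hz

/-- By induction: given independent vectors, a fresh Gaussian vector almost surely avoids their
span. -/
lemma ae_linearIndependent_stdGaussian (p : ℕ) (hp : p + 2 ≤ Module.finrank ℝ E) :
    ∀ᵐ C ∂Measure.pi fun _ : Fin p => stdGaussian E, LinearIndependent ℝ C := by
  induction p with
  | zero => exact ae_of_all _ fun C => linearIndependent_empty_type
  | succ p ih =>
    have hmeas : MeasurableSet {C : Fin (p + 1) → E | LinearIndependent ℝ C} := by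
      simp_rw [← Matrix.det_gram_ne_zero_iff_linearIndependent (𝕜 := ℝ)]
      exact (continuous_gram.matrix_det.measurable (measurableSet_singleton 0)).compl
    have hmp := measurePreserving_piFinSuccAbove (fun _ : Fin (p + 1) => stdGaussian E) 0
    have hprod : ∀ᵐ y ∂(stdGaussian E).prod (Measure.pi fun _ : Fin p => stdGaussian E),
        LinearIndependent ℝ (Fin.cons y.1 y.2 : Fin (p + 1) → E) := by
      have hc : Measurable fun y : E × (Fin p → E) => (Fin.cons y.1 y.2 : Fin (p + 1) → E) :=
        Continuous.measurable (by fun_prop)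
      -- The order of the quantifiers is exchanged so that `v` is fixed first and its span is a
      -- fixed subspace when `z` varies.
      refine (Measure.ae_prod_iff_ae_ae
        (p := fun y : E × (Fin p → E) => LinearIndependent ℝ (Fin.cons y.1 y.2 : Fin (p + 1) → E))
        (hc hmeas)).2 ((Measure.ae_ae_comm
        (p := fun z v => LinearIndependent ℝ (Fin.cons z v : Fin (p + 1) → E)) (hc hmeas)).2 ?_)
      filter_upwards [ih (by omega)] with v hv
      filter_upwards [ae_notMem_of_finrank_add_three_le (Submodule.span ℝ (Set.range v))
        (by rw [finrank_span_eq_card hv, Fintype.card_fin]; omega)] with z hz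
      exact linearIndependent_finCons.2 ⟨hv, hz⟩
    filter_upwards [hmp.quasiMeasurePreserving.ae hprod] with C hC
    have : (Fin.cons (MeasurableEquiv.piFinSuccAbove (fun _ => E) 0 C).1
      (MeasurableEquiv.piFinSuccAbove (fun _ => E) 0 C).2 : Fin (p + 1) → E) = C := by
      simp [MeasurableEquiv.piFinSuccAbove, Fin.tail_def]
      exact Fin.cons_self_tail C
    rwa [this] at hC

/-- The diagonal entries of an inverse Wishart matrix have mean `1 / (n - p - 1)`. -/
lemma lintegral_inv_gram_apply_self (p : ℕ) (hp : p + 2 ≤ Module.finrank ℝ E) (j : Fin p) :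
    ∫⁻ C, ENNReal.ofReal ((Matrix.gram ℝ C)⁻¹ j j) ∂Measure.pi (fun _ : Fin p => stdGaussian E) =
      ENNReal.ofReal (1 / ((Module.finrank ℝ E : ℝ) - p - 1)) := by
  cases p with
  | zero => exact j.elim0
  | succ q =>
    have hmp := (measurePreserving_piFinSuccAbove (fun _ : Fin (q + 1) => stdGaussian E) j).symm
    have hmeas : Measurable fun C : Fin (q + 1) → E =>
        ENNReal.ofReal ((Matrix.gram ℝ C)⁻¹ j j) :=
      (Measurable.matrix_inv_apply continuous_gram j j).ennreal_ofReal
    rw [← hmp.lintegral_comp hmeas,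
      lintegral_prod_symm (fun y => ENNReal.ofReal ((Matrix.gram ℝ
        ((MeasurableEquiv.piFinSuccAbove (fun _ => E) j).symm y))⁻¹ j j)) (hmeas.comp (MeasurableEquiv.measurable _)).aemeasurable]
    have hLI := Measure.ae_ae_of_ae_prod (Measure.measurePreserving_swap.quasiMeasurePreserving.ae
      (hmp.quasiMeasurePreserving.ae (ae_linearIndependent_stdGaussian (q + 1) hp)))
    have key : ∀ᵐ v ∂Measure.pi fun _ : Fin q => stdGaussian E,
        ∫⁻ z, ENNReal.ofReal ((Matrix.gram ℝ
          ((MeasurableEquiv.piFinSuccAbove (fun _ => E) j).symm (z, v)))⁻¹ j j) ∂stdGaussian E =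
        ENNReal.ofReal (1 / ((Module.finrank ℝ E : ℝ) - (q + 1 : ℕ) - 1)) := by
      filter_upwards [hLI, ae_linearIndependent_stdGaussian q (by omega)] with v hv hv'
      have hrank : Module.finrank ℝ (Submodule.span ℝ (Set.range v))ᗮ + q =
          Module.finrank ℝ E := by
        have := (Submodule.span ℝ (Set.range v)).finrank_add_finrank_orthogonal
        rw [finrank_span_eq_card hv', Fintype.card_fin] at this
        omega
      have h := lintegral_inv_norm_sq_orthogonalProjection_stdGaussian
        (Submodule.span ℝ (Set.range v))ᗮ (by omega)
      -- The complement of the `q` other vectors has dimension `finrank ℝ E - q`; the chi-squared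
      -- mean subtracts `2` more.
      rw [show (Module.finrank ℝ E : ℝ) - (q + 1 : ℕ) - 1 =
        (Module.finrank ℝ (Submodule.span ℝ (Set.range v))ᗮ : ℝ) - 2 by
          rw [← hrank]; push_cast; ring, ← h]
      refine lintegral_congr_ae ?_
      filter_upwards [hv, ae_notMem_of_finrank_add_three_le (Submodule.span ℝ (Set.range v))
        (by rw [finrank_span_eq_card hv', Fintype.card_fin]; omega)] with z hz hzv
      have hz' : LinearIndependent ℝ
        ((MeasurableEquiv.piFinSuccAbove (fun _ => E) j).symm (z, v)) := hz
      rw [inv_gram_apply_self hz']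
      have h1 : (MeasurableEquiv.piFinSuccAbove (fun _ => E) j).symm (z, v) j = z :=
        Fin.insertNth_apply_same (α := fun _ => E) j z v
      have h2 : (fun i => (MeasurableEquiv.piFinSuccAbove (fun _ => E) j).symm (z, v)
          (j.succAbove i)) = v := by
        funext i
        exact Fin.insertNth_apply_succAbove (α := fun _ => E) j z v i
      rw [h1, h2, ENNReal.ofReal_inv_of_pos]
      have h3 : (Submodule.span ℝ (Set.range v))ᗮ.orthogonalProjectionOnto z ≠ 0 := by
        rw [Ne, Submodule.orthogonalProjectionOnto_eq_zero_iff, Submodule.orthogonal_orthogonal]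
        exact hzv
      positivity
    exact (lintegral_congr_ae key).trans (by simp)

end GaussianGram

/-! ### Mean leverage of a new covariate and of a training covariate -/

section Leverage

/-- Transposing an i.i.d. array preserves its law: on products of boxes, which generate the
σ-algebra, both measures are the same double product. -/
lemma measurePreserving_pi_swap {ι κ α : Type*} [Fintype ι] [Fintype κ] [MeasurableSpace α]
    (μ : Measure α) [IsProbabilityMeasure μ] :
    MeasurePreserving (fun (X : ι → κ → α) (k : κ) (i : ι) => X i k)
      (Measure.pi fun _ => Measure.pi fun _ => μ) (Measure.pi fun _ => Measure.pi fun _ => μ) := by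
  have hm : Measurable (fun (X : ι → κ → α) (k : κ) (i : ι) => X i k) := by fun_prop
  refine ⟨hm, (Measure.pi_eq_generateFrom (fun _ => generateFrom_pi) (fun _ => isPiSystem_pi)
    (fun _ => Measure.FiniteSpanningSetsIn.pi fun _ => μ.toFiniteSpanningSetsIn) ?_).symm⟩
  intro s hs
  choose t ht hts using hs
  have hst : ∀ k, s k = Set.univ.pi (t k) := fun k => (hts k).symm
  have htm : ∀ k i, MeasurableSet (t k i) := fun k i => ht k i (Set.mem_univ i)
  rw [show s = fun k => Set.univ.pi (t k) from funext hst, Measure.map_apply hm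
    (MeasurableSet.univ_pi fun k => MeasurableSet.univ_pi fun i => htm k i)]
  have hpre : (fun (X : ι → κ → α) (k : κ) (i : ι) => X i k) ⁻¹'
      (Set.univ.pi fun k => Set.univ.pi (t k)) = Set.univ.pi fun i => Set.univ.pi fun k => t k i := by
    ext X
    simp only [Set.mem_preimage, Set.mem_pi, Set.mem_univ, true_imp_iff]
    exact forall_comm
  rw [hpre]
  simp_rw [Measure.pi_pi]
  exact Finset.prod_comm

variable {n p : ℕ}

/-- The matrix whose rows are the given vectors. -/
def designMatrix (X : Fin n → EuclideanSpace ℝ (Fin p)) : Matrix (Fin n) (Fin p) ℝ :=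
  .of fun i j => X i j

/-- The `p × p` matrix `XᵀX`. -/
def scatterMatrix (X : Fin n → EuclideanSpace ℝ (Fin p)) : Matrix (Fin p) (Fin p) ℝ :=
  (designMatrix X).transpose * designMatrix X

/-- The quadratic form `v ↦ vᵀ(XᵀX)⁻¹v`. -/
noncomputable def leverage (X : Fin n → EuclideanSpace ℝ (Fin p)) (v : EuclideanSpace ℝ (Fin p)) :
    ℝ :=
  v.ofLp ⬝ᵥ (scatterMatrix X)⁻¹.mulVec v.ofLp

/-- The columns of the matrix whose rows are the given vectors. -/
def columns (X : Fin n → EuclideanSpace ℝ (Fin p)) (j : Fin p) : EuclideanSpace ℝ (Fin n) :=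
  WithLp.toLp 2 fun i => X i j

lemma scatterMatrix_eq_gram_columns (X : Fin n → EuclideanSpace ℝ (Fin p)) :
    scatterMatrix X = Matrix.gram ℝ (columns X) := by
  ext j k
  simp [scatterMatrix, designMatrix, columns, Matrix.mul_apply, PiLp.inner_apply, mul_comm]

lemma continuous_designMatrix :
    Continuous (designMatrix : (Fin n → EuclideanSpace ℝ (Fin p)) → _) :=
  continuous_matrix fun i j => by
    simp only [designMatrix, Matrix.of_apply]
    fun_prop

lemma continuous_scatterMatrix :
    Continuous (scatterMatrix : (Fin n → EuclideanSpace ℝ (Fin p)) → _) :=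
  continuous_designMatrix.matrix_transpose.matrix_mul continuous_designMatrix

lemma measurable_leverage :
    Measurable fun z : (Fin n → EuclideanSpace ℝ (Fin p)) × EuclideanSpace ℝ (Fin p) =>
      leverage z.1 z.2 := by
  unfold leverage dotProduct Matrix.mulVec dotProduct
  have h := fun i j => (Measurable.matrix_inv_apply (continuous_scatterMatrix (n := n) (p := p)) i j)
  refine Finset.measurable_sum _ fun i _ => Measurable.mul (by fun_prop)
    (Finset.measurable_sum _ fun j _ => Measurable.mul ((h i j).comp measurable_fst) (by fun_prop))

/-- Standard Gaussian rows amount to an i.i.d. array of entries, whose transpose has standard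
Gaussian columns. -/
lemma measurePreserving_columns :
    MeasurePreserving (columns : (Fin n → EuclideanSpace ℝ (Fin p)) → _)
      (Measure.pi fun _ => stdGaussian (EuclideanSpace ℝ (Fin p)))
      (Measure.pi fun _ => stdGaussian (EuclideanSpace ℝ (Fin n))) := by
  have h1 : ∀ m : ℕ, MeasurePreserving (WithLp.toLp 2 : (Fin m → ℝ) → EuclideanSpace ℝ (Fin m))
      (Measure.pi fun _ => gaussianReal 0 1) (stdGaussian (EuclideanSpace ℝ (Fin m))) := fun m =>
    ⟨by fun_prop, map_pi_eq_stdGaussian⟩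
  have h2 : ∀ m : ℕ, MeasurePreserving (WithLp.ofLp : EuclideanSpace ℝ (Fin m) → (Fin m → ℝ))
      (stdGaussian (EuclideanSpace ℝ (Fin m))) (Measure.pi fun _ => gaussianReal 0 1) := fun m =>
    (h1 m).symm (MeasurableEquiv.toLp 2 (Fin m → ℝ))
  exact (measurePreserving_pi _ _ fun _ : Fin p => h1 n).comp
    ((measurePreserving_pi_swap (gaussianReal 0 1)).comp
      (measurePreserving_pi _ _ fun _ : Fin n => h2 p))

lemma ae_det_scatterMatrix_ne_zero_stdGaussian (hpn : p + 1 < n) :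
    ∀ᵐ X ∂Measure.pi fun _ : Fin n => stdGaussian (EuclideanSpace ℝ (Fin p)),
      (scatterMatrix X).det ≠ 0 := by
  filter_upwards [measurePreserving_columns.quasiMeasurePreserving.ae
    (ae_linearIndependent_stdGaussian (E := EuclideanSpace ℝ (Fin n)) p (by rw [finrank_euclideanSpace_fin]; omega))]
    with X hX
  rw [scatterMatrix_eq_gram_columns]
  exact Matrix.det_gram_ne_zero_iff_linearIndependent.2 hX

lemma lintegral_inv_scatterMatrix_apply_self (hpn : p + 1 < n) (j : Fin p) :
    ∫⁻ X, ENNReal.ofReal ((scatterMatrix X)⁻¹ j j)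
        ∂Measure.pi (fun _ : Fin n => stdGaussian (EuclideanSpace ℝ (Fin p))) =
      ENNReal.ofReal (1 / ((n : ℝ) - p - 1)) := by
  have h := lintegral_inv_gram_apply_self (E := EuclideanSpace ℝ (Fin n)) p (by rw [finrank_euclideanSpace_fin]; omega) j
  rw [finrank_euclideanSpace_fin] at h
  rw [← h, ← measurePreserving_columns.lintegral_comp
    (Measurable.matrix_inv_apply continuous_gram j j).ennreal_ofReal]
  simp_rw [scatterMatrix_eq_gram_columns]

lemma integral_mul_stdGaussian (i j : Fin p) :
    ∫ v, v i * v j ∂stdGaussian (EuclideanSpace ℝ (Fin p)) = if i = j then 1 else 0 := by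
  have hmem : ∀ i : Fin p,
      MemLp (fun v : EuclideanSpace ℝ (Fin p) => v i) 2 (stdGaussian (EuclideanSpace ℝ (Fin p))) :=
    fun i => IsGaussian.memLp_dual _ (EuclideanSpace.proj i) 2 (by simp)
  have hmean : ∀ i : Fin p, ∫ v, v i ∂stdGaussian (EuclideanSpace ℝ (Fin p)) = 0 := fun i =>
    integral_strongDual_stdGaussian (EuclideanSpace.proj (𝕜 := ℝ) i)
  have h := covariance_eval_multivariateGaussian (μ := (0 : EuclideanSpace ℝ (Fin p)))
    (S := 1) Matrix.PosSemidef.one i j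
  rw [multivariateGaussian_zero_one, covariance_eq_sub (hmem i) (hmem j), hmean, zero_mul,
    sub_zero, Matrix.one_apply] at h
  simpa using h

lemma posSemidef_inv_scatterMatrix (X : Fin n → EuclideanSpace ℝ (Fin p)) :
    (scatterMatrix X)⁻¹.PosSemidef := by
  rw [scatterMatrix_eq_gram_columns]
  exact (Matrix.posSemidef_gram ℝ _).inv

lemma leverage_nonneg (X : Fin n → EuclideanSpace ℝ (Fin p)) (v : EuclideanSpace ℝ (Fin p)) :
    0 ≤ leverage X v := by
  simpa [leverage] using (posSemidef_inv_scatterMatrix X).dotProduct_mulVec_nonneg v.ofLp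

/-- Since `v` has identity second-moment matrix, averaging the quadratic form leaves its trace. -/
lemma lintegral_leverage_stdGaussian_right (X : Fin n → EuclideanSpace ℝ (Fin p)) :
    ∫⁻ v, ENNReal.ofReal (leverage X v) ∂stdGaussian (EuclideanSpace ℝ (Fin p)) =
      ∑ j, ENNReal.ofReal ((scatterMatrix X)⁻¹ j j) := by
  have hint : ∀ i j : Fin p, Integrable (fun v : EuclideanSpace ℝ (Fin p) => v i * v j)
      (stdGaussian (EuclideanSpace ℝ (Fin p))) := fun i j =>
    MemLp.integrable_mul (IsGaussian.memLp_dual _ (EuclideanSpace.proj i) 2 (by simp))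
      (IsGaussian.memLp_dual _ (EuclideanSpace.proj j) 2 (by simp))
  have hexp : ∀ v, leverage X v = ∑ i, ∑ j, (scatterMatrix X)⁻¹ i j * (v i * v j) := by
    intro v
    simp only [leverage, dotProduct, Matrix.mulVec, Finset.mul_sum]
    exact Finset.sum_congr rfl fun i _ => Finset.sum_congr rfl fun j _ => by ring
  have hint2 : ∀ i j : Fin p, Integrable (fun v : EuclideanSpace ℝ (Fin p) =>
      (scatterMatrix X)⁻¹ i j * (v i * v j)) (stdGaussian (EuclideanSpace ℝ (Fin p))) :=
    fun i j => (hint i j).const_mul _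
  have hint1 : Integrable (leverage X) (stdGaussian (EuclideanSpace ℝ (Fin p))) := by
    rw [show leverage X = fun v => ∑ i, ∑ j, (scatterMatrix X)⁻¹ i j * (v i * v j) from funext hexp]
    exact integrable_finsetSum _ fun i _ => integrable_finsetSum _ fun j _ => hint2 i j
  rw [← ofReal_integral_eq_lintegral_ofReal hint1 (ae_of_all _ (leverage_nonneg X)),
    ← ENNReal.ofReal_sum_of_nonneg fun j _ => (posSemidef_inv_scatterMatrix X).diag_nonneg]
  congr 1
  simp_rw [hexp]
  rw [integral_finsetSum _ fun i _ => integrable_finsetSum _ fun j _ => hint2 i j]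
  refine Finset.sum_congr rfl fun i _ => ?_
  rw [integral_finsetSum _ fun j _ => hint2 i j]
  simp_rw [integral_const_mul, integral_mul_stdGaussian]
  simp

lemma lintegral_leverage_stdGaussian (hpn : p + 1 < n) :
    ∫⁻ z, ENNReal.ofReal (leverage z.1 z.2)
      ∂(Measure.pi fun _ : Fin n => stdGaussian (EuclideanSpace ℝ (Fin p))).prod
        (stdGaussian (EuclideanSpace ℝ (Fin p))) =
      ENNReal.ofReal (p / ((n : ℝ) - p - 1)) := by
  rw [lintegral_prod _ measurable_leverage.ennreal_ofReal.aemeasurable]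
  simp_rw [lintegral_leverage_stdGaussian_right]
  rw [lintegral_finsetSum _ fun j _ =>
    (Measurable.matrix_inv_apply continuous_scatterMatrix j j).ennreal_ofReal]
  simp_rw [lintegral_inv_scatterMatrix_apply_self hpn]
  have : (0 : ℝ) ≤ (n : ℝ) - p - 1 := by
    have : (p : ℝ) + 1 < n := by exact_mod_cast hpn
    linarith
  rw [Finset.sum_const, Finset.card_univ, Fintype.card_fin, nsmul_eq_mul,
    ← ENNReal.ofReal_natCast, ← ENNReal.ofReal_mul (by positivity)]
  congr 1
  ring

lemma designMatrix_toEuclideanCLM (A : Matrix (Fin p) (Fin p) ℝ)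
    (X : Fin n → EuclideanSpace ℝ (Fin p)) :
    designMatrix (fun i => Matrix.toEuclideanCLM (𝕜 := ℝ) A (X i)) =
      designMatrix X * A.transpose := by
  ext i j
  simp [designMatrix, Matrix.mul_apply, Matrix.mulVec, dotProduct, mul_comm]

lemma scatterMatrix_toEuclideanCLM (A : Matrix (Fin p) (Fin p) ℝ)
    (X : Fin n → EuclideanSpace ℝ (Fin p)) :
    scatterMatrix (fun i => Matrix.toEuclideanCLM (𝕜 := ℝ) A (X i)) =
      A * scatterMatrix X * A.transpose := by
  rw [scatterMatrix, designMatrix_toEuclideanCLM, scatterMatrix, Matrix.transpose_mul,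
    Matrix.transpose_transpose]
  simp only [Matrix.mul_assoc]

/-- The factors of `A` cancel in `(Av)ᵀ(A XᵀX Aᵀ)⁻¹(Av)`. This is why `Σ` drops out of the answer.
-/
lemma leverage_toEuclideanCLM {A : Matrix (Fin p) (Fin p) ℝ} (hA : IsUnit A.det)
    (X : Fin n → EuclideanSpace ℝ (Fin p)) (v : EuclideanSpace ℝ (Fin p)) :
    leverage (fun i => Matrix.toEuclideanCLM (𝕜 := ℝ) A (X i))
      (Matrix.toEuclideanCLM (𝕜 := ℝ) A v) = leverage X v := by
  rw [leverage, scatterMatrix_toEuclideanCLM, Matrix.mul_inv_rev, Matrix.mul_inv_rev,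
    Matrix.ofLp_toEuclideanCLM, leverage]
  rw [Matrix.mulVec_mulVec, Matrix.mul_assoc, Matrix.mul_assoc, Matrix.nonsing_inv_mul _ hA,
    Matrix.mul_one, ← Matrix.vecMul_transpose, ← Matrix.dotProduct_mulVec, Matrix.mulVec_mulVec,
    ← Matrix.mul_assoc, Matrix.mul_nonsing_inv _ (by rwa [Matrix.det_transpose]), Matrix.one_mul]

open scoped MatrixOrder in
lemma isUnit_det_sqrt {S : Matrix (Fin p) (Fin p) ℝ} (hS : S.PosSemidef) (hSinv : IsUnit S) :
    IsUnit (CFC.sqrt S).det := by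
  have h : CFC.sqrt S * CFC.sqrt S = S := CFC.sqrt_mul_sqrt_self S hS.nonneg
  rw [Matrix.isUnit_iff_isUnit_det, ← h, Matrix.det_mul] at hSinv
  exact isUnit_of_mul_isUnit_left hSinv

open scoped MatrixOrder in
lemma measurePreserving_sqrt_multivariateGaussian (S : Matrix (Fin p) (Fin p) ℝ) :
    MeasurePreserving (Matrix.toEuclideanCLM (𝕜 := ℝ) (CFC.sqrt S))
      (stdGaussian (EuclideanSpace ℝ (Fin p))) (multivariateGaussian 0 S) :=
  ⟨by fun_prop, by simp [multivariateGaussian]⟩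

lemma lintegral_leverage_multivariateGaussian (hpn : p + 1 < n) {S : Matrix (Fin p) (Fin p) ℝ}
    (hS : S.PosSemidef) (hSinv : IsUnit S) :
    ∫⁻ z, ENNReal.ofReal (leverage z.1 z.2)
      ∂(Measure.pi fun _ : Fin n => multivariateGaussian 0 S).prod (multivariateGaussian 0 S) =
      ENNReal.ofReal (p / ((n : ℝ) - p - 1)) := by
  have h1 := measurePreserving_sqrt_multivariateGaussian S
  have h := (measurePreserving_pi _ _ fun _ : Fin n => h1).prod h1
  rw [← lintegral_leverage_stdGaussian hpn,
    ← h.lintegral_comp measurable_leverage.ennreal_ofReal]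
  refine lintegral_congr fun z => ?_
  exact congrArg _ (leverage_toEuclideanCLM (isUnit_det_sqrt hS hSinv) z.1 z.2)

lemma ae_det_scatterMatrix_ne_zero (hpn : p + 1 < n) {S : Matrix (Fin p) (Fin p) ℝ}
    (hS : S.PosSemidef) (hSinv : IsUnit S) :
    ∀ᵐ X ∂Measure.pi fun _ : Fin n => multivariateGaussian (0 : EuclideanSpace ℝ (Fin p)) S,
      (scatterMatrix X).det ≠ 0 := by
  have h1 := measurePreserving_sqrt_multivariateGaussian S
  have h := measurePreserving_pi _ _ fun _ : Fin n => h1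
  rw [← h.map_eq, ae_map_iff h.measurable.aemeasurable]
  · filter_upwards [ae_det_scatterMatrix_ne_zero_stdGaussian hpn] with X hX
    have hA := (isUnit_det_sqrt hS hSinv).ne_zero
    rw [scatterMatrix_toEuclideanCLM, Matrix.det_mul, Matrix.det_mul, Matrix.det_transpose]
    exact mul_ne_zero (mul_ne_zero hA hX) hA
  · exact (continuous_scatterMatrix.matrix_det.measurable (measurableSet_singleton 0)).compl

/-- The leverages are the diagonal entries of the hat matrix `X(XᵀX)⁻¹Xᵀ`, whose trace is that of
the `p × p` identity by cyclicity. -/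
lemma sum_leverage_self {X : Fin n → EuclideanSpace ℝ (Fin p)} (hX : (scatterMatrix X).det ≠ 0) :
    ∑ i, leverage X (X i) = p := by
  have h : ∀ i, leverage X (X i) =
      (designMatrix X * (scatterMatrix X)⁻¹ * (designMatrix X).transpose) i i := by
    intro i
    rw [leverage, Matrix.mul_assoc, Matrix.mul_apply]
    simp [designMatrix, dotProduct, Matrix.mulVec, Matrix.mul_apply]
  simp_rw [h]
  change Matrix.trace _ = _
  rw [Matrix.trace_mul_comm, ← Matrix.mul_assoc, ← scatterMatrix,
    Matrix.mul_nonsing_inv _ hX.isUnit, Matrix.trace_one, Fintype.card_fin]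

lemma scatterMatrix_comp_equiv (X : Fin n → EuclideanSpace ℝ (Fin p)) (e : Fin n ≃ Fin n) :
    scatterMatrix (fun i => X (e i)) = scatterMatrix X := by
  ext j k
  simp only [scatterMatrix, designMatrix, Matrix.mul_apply, Matrix.transpose_apply,
    Matrix.of_apply]
  exact e.sum_comp fun i => X i j * X i k

/-- Permuting the rows fixes both `XᵀX` and the product law, so all rows have the same mean
leverage, and these means add up to `p`. -/
lemma lintegral_leverage_self {Q : Measure (EuclideanSpace ℝ (Fin p))} [IsProbabilityMeasure Q]
    (hQ : ∀ᵐ X ∂Measure.pi fun _ : Fin n => Q, (scatterMatrix X).det ≠ 0) (i : Fin n) :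
    ∫⁻ X, ENNReal.ofReal (leverage X (X i)) ∂Measure.pi (fun _ : Fin n => Q) =
      ENNReal.ofReal (p / n) := by
  have hm : ∀ k : Fin n, Measurable fun X : Fin n → EuclideanSpace ℝ (Fin p) =>
      ENNReal.ofReal (leverage X (X k)) := fun k =>
    (measurable_leverage.comp (measurable_id.prodMk (measurable_pi_apply k))).ennreal_ofReal
  have hsymm : ∀ k, ∫⁻ X, ENNReal.ofReal (leverage X (X k)) ∂Measure.pi (fun _ : Fin n => Q) =
      ∫⁻ X, ENNReal.ofReal (leverage X (X i)) ∂Measure.pi (fun _ : Fin n => Q) := by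
    intro k
    have h := measurePreserving_piCongrLeft (fun _ : Fin n => Q) (Equiv.swap i k)
    rw [← h.lintegral_comp (hm k)]
    refine lintegral_congr fun X => ?_
    have hX : MeasurableEquiv.piCongrLeft (fun _ => EuclideanSpace ℝ (Fin p)) (Equiv.swap i k) X =
        fun l => X ((Equiv.swap i k) l) := by
      funext l
      simp only [MeasurableEquiv.coe_piCongrLeft, Equiv.piCongrLeft_apply, Equiv.symm_swap]
      exact eq_rec_constant _ _
    simp only [hX, leverage, scatterMatrix_comp_equiv, Equiv.swap_apply_right]
  have hsum : ∑ k, ∫⁻ X, ENNReal.ofReal (leverage X (X k)) ∂Measure.pi (fun _ : Fin n => Q) =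
      p := by
    rw [← lintegral_finsetSum _ fun k _ => hm k]
    have : ∀ᵐ X ∂Measure.pi fun _ : Fin n => Q,
        ∑ k, ENNReal.ofReal (leverage X (X k)) = (p : ℝ≥0∞) := by
      filter_upwards [hQ] with X hX
      rw [← ENNReal.ofReal_sum_of_nonneg fun k _ => leverage_nonneg X (X k), sum_leverage_self hX,
        ENNReal.ofReal_natCast]
    rw [lintegral_congr_ae this]
    simp
  simp_rw [hsymm] at hsum
  rw [Finset.sum_const, Finset.card_univ, Fintype.card_fin, nsmul_eq_mul] at hsum
  have hn : 0 < n := i.pos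
  rw [ENNReal.ofReal_div_of_pos (by exact_mod_cast hn), ENNReal.ofReal_natCast,
    ENNReal.ofReal_natCast, ← hsum, mul_comm, ENNReal.mul_div_cancel_right] <;> simp [hn.ne']

end Leverage

/-! ### Least squares predictions as linear functions of the responses -/

section LeastSquares

variable {n p : ℕ}

/-- The coefficients expressing the least squares prediction at `v` as a linear combination of the
responses. -/
noncomputable def leastSquaresWeight (X : Fin n → EuclideanSpace ℝ (Fin p))
    (v : EuclideanSpace ℝ (Fin p)) : Fin n → ℝ :=
  (designMatrix X).mulVec ((scatterMatrix X)⁻¹.mulVec v.ofLp)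

lemma measurable_leastSquaresWeight :
    Measurable fun z : (Fin n → EuclideanSpace ℝ (Fin p)) × EuclideanSpace ℝ (Fin p) =>
      leastSquaresWeight z.1 z.2 := by
  unfold leastSquaresWeight designMatrix Matrix.mulVec dotProduct
  have h := fun i j => (Measurable.matrix_inv_apply (continuous_scatterMatrix (n := n) (p := p)) i j)
  refine measurable_pi_lambda _ fun i => Finset.measurable_sum _ fun k _ => Measurable.mul
    (by simp only [Matrix.of_apply]; fun_prop)
    (Finset.measurable_sum _ fun j _ => Measurable.mul ((h k j).comp measurable_fst) (by fun_prop))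

lemma transpose_scatterMatrix (X : Fin n → EuclideanSpace ℝ (Fin p)) :
    (scatterMatrix X).transpose = scatterMatrix X := by
  simp [scatterMatrix, Matrix.transpose_mul]

lemma leastSquaresWeight_dotProduct (X : Fin n → EuclideanSpace ℝ (Fin p))
    (v : EuclideanSpace ℝ (Fin p)) (Y : Fin n → ℝ) :
    leastSquaresWeight X v ⬝ᵥ Y =
      v.ofLp ⬝ᵥ (scatterMatrix X)⁻¹.mulVec ((designMatrix X).transpose.mulVec Y) := by
  rw [leastSquaresWeight, Matrix.dotProduct_mulVec v.ofLp, ← Matrix.mulVec_transpose,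
    Matrix.transpose_nonsing_inv, transpose_scatterMatrix, Matrix.dotProduct_mulVec,
    Matrix.vecMul_transpose]

/-- The weights reproduce `v`, that is `Xᵀw = v`; hence `w ⬝ᵥ w = vᵀ(XᵀX)⁻¹Xᵀw = vᵀ(XᵀX)⁻¹v`. -/
lemma sum_sq_leastSquaresWeight {X : Fin n → EuclideanSpace ℝ (Fin p)}
    (hX : (scatterMatrix X).det ≠ 0) (v : EuclideanSpace ℝ (Fin p)) :
    ∑ i, leastSquaresWeight X v i ^ 2 = leverage X v := by
  have h : (designMatrix X).transpose.mulVec (leastSquaresWeight X v) = v.ofLp := by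
    rw [leastSquaresWeight, Matrix.mulVec_mulVec]
    change (scatterMatrix X).mulVec _ = _
    rw [Matrix.mulVec_mulVec, Matrix.mul_nonsing_inv _ hX.isUnit, Matrix.one_mulVec]
  have h' := leastSquaresWeight_dotProduct X v (leastSquaresWeight X v)
  rw [h, ← leverage] at h'
  rw [← h']
  simp [dotProduct, sq]

/-- The residual `r` of the normal-equation solution `β` is orthogonal to the column space. Hence by
Pythagoras a minimizer `b` satisfies `‖X(b - β)‖² ≤ 0`, and invertibility of `XᵀX` forces `b = β`.
-/
lemma IsLeastSquares.eq_leastSquaresWeight_dotProduct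
    {fhat : (Fin n → EuclideanSpace ℝ (Fin p)) → (Fin n → ℝ) → EuclideanSpace ℝ (Fin p) → ℝ}
    (hfhat : IsLeastSquares fhat) {X : Fin n → EuclideanSpace ℝ (Fin p)}
    (hX : (scatterMatrix X).det ≠ 0) (Y : Fin n → ℝ) (v : EuclideanSpace ℝ (Fin p)) :
    fhat X Y v = leastSquaresWeight X v ⬝ᵥ Y := by
  obtain ⟨b, hb, hfb⟩ := hfhat X Y
  set D := designMatrix X
  set β := (scatterMatrix X)⁻¹.mulVec (D.transpose.mulVec Y) with hβ
  have hinner : ∀ (c : EuclideanSpace ℝ (Fin p)) i, inner ℝ c (X i) = D.mulVec c.ofLp i := by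
    intro c i
    simp [PiLp.inner_apply, Matrix.mulVec, dotProduct, D, designMatrix]
  set d := b.ofLp - β with hd
  set r := Y - D.mulVec β with hr
  have hDr : D.transpose.mulVec r = 0 := by
    rw [hr, Matrix.mulVec_sub, hβ, Matrix.mulVec_mulVec, Matrix.mulVec_mulVec]
    change _ - (scatterMatrix X * _).mulVec _ = 0
    rw [Matrix.mul_nonsing_inv _ hX.isUnit, Matrix.one_mulVec, sub_self]
  have hcross : r ⬝ᵥ D.mulVec d = 0 := by
    rw [Matrix.dotProduct_mulVec, ← Matrix.mulVec_transpose, hDr, zero_dotProduct]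
  have hsumb : ∑ i, (Y i - inner ℝ b (X i)) ^ 2 = (r - D.mulVec d) ⬝ᵥ (r - D.mulVec d) := by
    refine Finset.sum_congr rfl fun i _ => ?_
    rw [hinner, hr, hd, Matrix.mulVec_sub]
    simp only [Pi.sub_apply]
    ring
  have hsumβ : ∑ i, (Y i - inner ℝ (WithLp.toLp 2 β) (X i)) ^ 2 = r ⬝ᵥ r := by
    refine Finset.sum_congr rfl fun i _ => ?_
    rw [hinner, hr]
    simp only [Pi.sub_apply]
    ring
  have hle := hb (WithLp.toLp 2 β)
  rw [hsumb, hsumβ, sub_dotProduct, dotProduct_sub r, dotProduct_sub (D.mulVec d),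
    dotProduct_comm (D.mulVec d) r, hcross] at hle
  have hDd : D.mulVec d = 0 := by
    rw [← dotProduct_self_eq_zero]
    refine le_antisymm (by linarith) ?_
    exact Finset.sum_nonneg fun i _ => mul_self_nonneg _
  have hd0 : d = 0 := by
    refine Matrix.eq_zero_of_mulVec_eq_zero hX ?_
    rw [scatterMatrix, ← Matrix.mulVec_mulVec]
    exact (congrArg _ hDd).trans (Matrix.mulVec_zero _)
  have hbβ : b.ofLp = β := sub_eq_zero.1 hd0
  rw [hfb, leastSquaresWeight_dotProduct, ← hβ, ← hbβ]
  simp [PiLp.inner_apply, dotProduct]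

end LeastSquares

/-! ### Conditional variance of an affine function of independent noise -/

section ConditionalVariance

variable {Ω β γ : Type*} [MeasurableSpace Ω] [MeasurableSpace β] [MeasurableSpace γ]
  {μ : Measure Ω} [IsFiniteMeasure μ] {ρ : Measure β} [IsProbabilityMeasure ρ]
  {π : Measure γ} [IsProbabilityMeasure π] {W : Ω → β} {V : Ω → γ}

/-- As `V` is independent of `W`, conditioning on `W = w` just freezes the first argument of `g`;
almost everywhere uniqueness of conditional distributions does the rest. -/
lemma condDistrib_ae_eq_map_of_hasLaw_prod
    (h : HasLaw (fun ω => (W ω, V ω)) (ρ.prod π) μ) {g : β × γ → ℝ} (hg : Measurable g) :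
    ∀ᵐ w ∂ρ, condDistrib (fun ω => g (W ω, V ω)) W μ w = π.map fun v => g (w, v) := by
  have hW : HasLaw W ρ μ := (measurePreserving_fst (ν := π)).hasLaw.comp h
  have hZ : AEMeasurable (fun ω => g (W ω, V ω)) μ := hg.comp_aemeasurable h.aemeasurable
  let κ : Kernel β ℝ := (Kernel.id ×ₖ Kernel.const β π).map g
  have hκ : ∀ w, κ w = π.map fun v => g (w, v) := by
    intro w
    rw [Kernel.map_apply _ hg, Kernel.prod_apply, Kernel.id_apply, Kernel.const_apply,
      Measure.dirac_prod, Measure.map_map hg (by fun_prop)]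
    rfl
  have : IsMarkovKernel κ := Kernel.IsMarkovKernel.map _ hg
  have hgm : Measurable fun z : β × γ => (z.1, g z) := measurable_fst.prodMk hg
  have hcomp : μ.map (fun ω => (W ω, g (W ω, V ω))) = μ.map W ⊗ₘ κ := by
    rw [hW.map_eq, show (fun ω => (W ω, g (W ω, V ω))) =
      (fun z : β × γ => (z.1, g z)) ∘ fun ω => (W ω, V ω) from rfl,
      ← AEMeasurable.map_map_of_aemeasurable hgm.aemeasurable h.aemeasurable, h.map_eq]
    ext s hs
    rw [Measure.map_apply hgm hs, Measure.prod_apply (hgm hs), Measure.compProd_apply hs]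
    refine lintegral_congr fun w => ?_
    rw [hκ, Measure.map_apply (by fun_prop) (measurable_prodMk_left hs)]
    rfl
  have := condDistrib_ae_eq_of_measure_eq_compProd W hZ hcomp
  rw [hW.map_eq] at this
  filter_upwards [this] with w hw
  rw [hw, hκ]

/-- Once `W` is frozen, `c` is a constant and the variances of the independent terms add. Requiring
the affine form only almost everywhere leaves room for singular designs, where the least squares
prediction is not determined. -/
lemma integratedCondVar_affine {n : ℕ} {ν : Measure ℝ} [IsProbabilityMeasure ν]
    (hν : MemLp id 2 ν) {V : Ω → Fin n → ℝ}
    (h : HasLaw (fun ω => (W ω, V ω)) (ρ.prod (Measure.pi fun _ => ν)) μ)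
    {a : β → Fin n → ℝ} (ha : Measurable a) {c : β → ℝ} (hc : Measurable c) {Z : Ω → ℝ}
    (hZ : ∀ᵐ ω ∂μ, Z ω = c (W ω) + ∑ i, a (W ω) i * V ω i) :
    integratedCondVar μ Z W = ∫⁻ w, ENNReal.ofReal (∑ i, a w i ^ 2 * Var[id; ν]) ∂ρ := by
  have hW : HasLaw W ρ μ := (measurePreserving_fst (ν := Measure.pi fun _ : Fin n => ν)).hasLaw.comp h
  let g : β × (Fin n → ℝ) → ℝ := fun z => c z.1 + ∑ i, a z.1 i * z.2 i
  have hg : Measurable g := by fun_prop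
  have hvar : ∀ w, eVar[id; (Measure.pi fun _ : Fin n => ν).map fun v => g (w, v)] =
      ENNReal.ofReal (∑ i, a w i ^ 2 * Var[id; ν]) := by
    intro w
    have hgw : Measurable fun v => g (w, v) := by fun_prop
    have hterm : ∀ i, MemLp (fun t : ℝ => a w i * t) 2 ν := fun i => hν.const_mul _
    have hsum : MemLp (fun v : Fin n → ℝ => ∑ i, a w i * v i) 2 (Measure.pi fun _ => ν) :=
      memLp_finsetSum _ fun i _ => (hterm i).comp_measurePreserving (measurePreserving_eval _ i)
    have hgL : MemLp (fun v => g (w, v)) 2 (Measure.pi fun _ => ν) :=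
      (memLp_const (c w)).add hsum
    have hid : MemLp id 2 ((Measure.pi fun _ : Fin n => ν).map fun v => g (w, v)) :=
      (memLp_map_measure_iff aestronglyMeasurable_id hgw.aemeasurable).2 hgL
    have : IsProbabilityMeasure ((Measure.pi fun _ : Fin n => ν).map fun v => g (w, v)) :=
      Measure.isProbabilityMeasure_map hgw.aemeasurable
    rw [← ofReal_variance hid, variance_id_map hgw.aemeasurable]
    congr 1
    simp only [g]
    rw [variance_const_add hsum.aestronglyMeasurable]
    have := variance_sum_pi (μ := fun _ : Fin n => ν) (X := fun i t => a w i * t) hterm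
    rw [show (fun v : Fin n → ℝ => ∑ i, a w i * v i) = ∑ i, fun v : Fin n → ℝ => a w i * v i by
      ext; simp, this]
    exact Finset.sum_congr rfl fun i _ => variance_const_mul _ id ν
  have hcond : ∀ᵐ ω ∂μ, condDistrib Z W μ (W ω) =
      (Measure.pi fun _ : Fin n => ν).map fun v => g (W ω, v) := by
    rw [condDistrib_congr_left (Y' := fun ω => g (W ω, V ω)) hZ]
    have := condDistrib_ae_eq_map_of_hasLaw_prod h hg
    rw [← hW.map_eq] at this
    exact ae_of_ae_map hW.aemeasurable this
  rw [integratedCondVar, ← hW.map_eq, lintegral_map' (by fun_prop) hW.aemeasurable]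
  refine lintegral_congr_ae ?_
  filter_upwards [hcond] with ω hω
  rw [hω, hvar]

end ConditionalVariance

/-! ### The error distribution -/

section RegressionModel

variable {p : ℕ} {P : Measure (EuclideanSpace ℝ (Fin p) × ℝ)} [IsProbabilityMeasure P]
  {f : EuclideanSpace ℝ (Fin p) → ℝ} {σ : ℝ}

lemma IsRegressionModel.measurePreserving (hP : IsRegressionModel P f σ) :
    MeasurePreserving (fun z : EuclideanSpace ℝ (Fin p) × ℝ => (z.1, z.2 - f z.1)) P
      ((P.map Prod.fst).prod (P.map fun z => z.2 - f z.1)) := by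
  have hf := hP.measurable_f
  have hm : Measurable fun z : EuclideanSpace ℝ (Fin p) × ℝ => z.2 - f z.1 := by fun_prop
  exact ⟨by fun_prop, (indepFun_iff_map_prod_eq_prod_map_map measurable_fst.aemeasurable
    hm.aemeasurable).1 hP.indep_error.symm⟩

lemma IsRegressionModel.memLp_error_and_variance_error (hP : IsRegressionModel P f σ) :
    MemLp id 2 (P.map fun z => z.2 - f z.1) ∧ Var[id; P.map fun z => z.2 - f z.1] = σ ^ 2 := by
  have hf := hP.measurable_f
  have hm : Measurable fun z : EuclideanSpace ℝ (Fin p) × ℝ => z.2 - f z.1 := by fun_prop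
  set ν := P.map fun z => z.2 - f z.1 with hν
  have : IsProbabilityMeasure ν := Measure.isProbabilityMeasure_map hm.aemeasurable
  have : IsProbabilityMeasure (P.map Prod.fst) :=
    Measure.isProbabilityMeasure_map measurable_fst.aemeasurable
  have hmp := hP.measurePreserving
  have h := condDistrib_ae_eq_map_of_hasLaw_prod (μ := P) (W := Prod.fst)
    (V := fun z => z.2 - f z.1) ⟨hmp.measurable.aemeasurable, hmp.map_eq⟩
    (g := fun z => f z.1 + z.2) (by fun_prop)
  simp only [add_sub_cancel] at h
  -- A single good covariate value suffices: there the conditional law of `y` is the error law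
  -- translated by `f z.1`. Its finite extended variance gives square integrability, and translation
  -- does not change the variance.
  obtain ⟨z, hz, hz'⟩ := ((ae_of_ae_map measurable_fst.aemeasurable h).and hP.condVar_eq).exists
  set c := f z.1
  have hmc : Measurable fun v : ℝ => c + v := by fun_prop
  have hev : eVar[id; ν.map fun v => c + v] = ENNReal.ofReal (σ ^ 2) := by rw [← hz, ← hz']
  have : IsProbabilityMeasure (ν.map fun v => c + v) :=
    Measure.isProbabilityMeasure_map hmc.aemeasurable
  have hL : MemLp id 2 (ν.map fun v => c + v) :=
    (evariance_lt_top_iff_memLp aestronglyMeasurable_id).1 (hev ▸ ENNReal.ofReal_lt_top)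
  have hL1 : MemLp (fun v => c + v) 2 ν :=
    (memLp_map_measure_iff aestronglyMeasurable_id hmc.aemeasurable).1 hL
  have hL2 : MemLp id 2 ν := by
    convert hL1.sub (memLp_const c) using 1
    ext v
    simp
  refine ⟨hL2, ?_⟩
  rw [← ofReal_variance hL, variance_id_map hmc.aemeasurable] at hev
  have h1 : Var[fun v => c + v; ν] = Var[id; ν] := variance_const_add aestronglyMeasurable_id c
  rw [h1] at hev
  exact (ENNReal.ofReal_eq_ofReal_iff (variance_nonneg _ _) (sq_nonneg _)).1 hev

end RegressionModel

/-! ### Joint law of covariates and errors -/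

section JointLaw

lemma hasLaw_pi_of_iIndepFun {Ω α : Type*} [MeasurableSpace Ω] [MeasurableSpace α]
    {μ : Measure Ω} [IsProbabilityMeasure μ] {n : ℕ} {P : Measure α} {z : Fin n → Ω → α}
    (hlaw : ∀ i, HasLaw (z i) P μ)
    (hindep : iIndepFun z μ) :
    HasLaw (fun ω i => z i ω) (Measure.pi fun _ => P) μ := by
  refine ⟨aemeasurable_pi_lambda _ fun i => (hlaw i).aemeasurable, ?_⟩
  rw [(iIndepFun_iff_map_fun_eq_pi_map fun i => (hlaw i).aemeasurable).1 hindep]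
  simp_rw [fun i => (hlaw i).map_eq]

variable {Ω : Type*} [MeasurableSpace Ω] {μ : Measure Ω} [IsProbabilityMeasure μ] {n p : ℕ}
  {P : Measure (EuclideanSpace ℝ (Fin p) × ℝ)} [IsProbabilityMeasure P]
  {f : EuclideanSpace ℝ (Fin p) → ℝ} {σ : ℝ}
  {x : Fin n → Ω → EuclideanSpace ℝ (Fin p)} {y : Fin n → Ω → ℝ}

lemma IsRegressionModel.measurePreserving_pi (hP : IsRegressionModel P f σ) (n : ℕ) :
    MeasurePreserving (fun z : Fin n → EuclideanSpace ℝ (Fin p) × ℝ =>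
        ((fun i => (z i).1), fun i => (z i).2 - f (z i).1)) (Measure.pi fun _ => P)
      ((Measure.pi fun _ => P.map Prod.fst).prod
        (Measure.pi fun _ => P.map fun z => z.2 - f z.1)) := by
  have hf := hP.measurable_f
  have hm : Measurable fun z : EuclideanSpace ℝ (Fin p) × ℝ => z.2 - f z.1 := by fun_prop
  have : IsProbabilityMeasure (P.map Prod.fst) :=
    Measure.isProbabilityMeasure_map measurable_fst.aemeasurable
  have : IsProbabilityMeasure (P.map fun z => z.2 - f z.1) :=
    Measure.isProbabilityMeasure_map hm.aemeasurable
  exact (measurePreserving_arrowProdEquivProdArrow _ _ _ _ _).comp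
    (MeasureTheory.measurePreserving_pi _ _ fun _ : Fin n => hP.measurePreserving)

lemma IsRegressionModel.hasLaw_covariates_error (hP : IsRegressionModel P f σ)
    (hlaw : ∀ i, HasLaw (fun ω => (x i ω, y i ω)) P μ)
    (hindep : iIndepFun (fun i ω => (x i ω, y i ω)) μ) :
    HasLaw (fun ω => ((fun i => x i ω), fun i => y i ω - f (x i ω)))
      ((Measure.pi fun _ => P.map Prod.fst).prod
        (Measure.pi fun _ => P.map fun z => z.2 - f z.1)) μ :=
  HasLaw.comp (hP.measurePreserving_pi n).hasLaw (hasLaw_pi_of_iIndepFun hlaw hindep)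

lemma IsRegressionModel.hasLaw_covariates_newCovariate_error (hP : IsRegressionModel P f σ)
    (hlaw : ∀ i, HasLaw (fun ω => (x i ω, y i ω)) P μ)
    (hindep : iIndepFun (fun i ω => (x i ω, y i ω)) μ)
    {x₀ : Ω → EuclideanSpace ℝ (Fin p)} {y₀ : Ω → ℝ}
    (hlaw₀ : HasLaw (fun ω => (x₀ ω, y₀ ω)) P μ)
    (hindep₀ : IndepFun (fun ω i => (x i ω, y i ω)) (fun ω => (x₀ ω, y₀ ω)) μ) :
    HasLaw (fun ω => (((fun i => x i ω), x₀ ω), fun i => y i ω - f (x i ω)))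
      (((Measure.pi fun _ => P.map Prod.fst).prod (P.map Prod.fst)).prod
        (Measure.pi fun _ => P.map fun z => z.2 - f z.1)) μ := by
  have hf := hP.measurable_f
  have hm : Measurable fun z : EuclideanSpace ℝ (Fin p) × ℝ => z.2 - f z.1 := by fun_prop
  have : IsProbabilityMeasure (P.map Prod.fst) :=
    Measure.isProbabilityMeasure_map measurable_fst.aemeasurable
  have : IsProbabilityMeasure (P.map fun z => z.2 - f z.1) :=
    Measure.isProbabilityMeasure_map hm.aemeasurable
  have hxy := hasLaw_pi_of_iIndepFun hlaw hindep
  have hjoint : HasLaw (fun ω => ((fun i => (x i ω, y i ω)), (x₀ ω, y₀ ω)))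
      ((Measure.pi fun _ => P).prod P) μ := by
    refine ⟨hxy.aemeasurable.prodMk hlaw₀.aemeasurable, ?_⟩
    rw [(indepFun_iff_map_prod_eq_prod_map_map hxy.aemeasurable hlaw₀.aemeasurable).1 hindep₀,
      hxy.map_eq, hlaw₀.map_eq]
  have hfst : MeasurePreserving (Prod.fst : EuclideanSpace ℝ (Fin p) × ℝ → _) P (P.map Prod.fst) :=
    ⟨measurable_fst, rfl⟩
  have hmp := (hP.measurePreserving_pi n).prod hfst
  -- Regroup `((X, ε), x₀)` as `((X, x₀), ε)`, so that the conditioning variable comes first.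
  have hassoc := measurePreserving_prodAssoc (Measure.pi fun _ : Fin n => P.map Prod.fst)
    (Measure.pi fun _ : Fin n => P.map fun z => z.2 - f z.1) (P.map Prod.fst)
  have hassoc' := (measurePreserving_prodAssoc (Measure.pi fun _ : Fin n => P.map Prod.fst)
    (P.map Prod.fst) (Measure.pi fun _ : Fin n => P.map fun z => z.2 - f z.1)).symm
  have hswap := (MeasurePreserving.id (Measure.pi fun _ : Fin n => P.map Prod.fst)).prod
    (Measure.measurePreserving_swap
      (μ := Measure.pi fun _ : Fin n => P.map fun z => z.2 - f z.1) (ν := P.map Prod.fst))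
  exact HasLaw.comp (((hassoc'.comp hswap).comp hassoc).comp hmp).hasLaw hjoint

end JointLaw

/-! ### The excess variance -/

theorem theorem2 {Ω : Type*} [MeasurableSpace Ω] (μ : Measure Ω) [IsProbabilityMeasure μ]
    (n p : ℕ) (hpn : p + 1 < n)
    (P : Measure (EuclideanSpace ℝ (Fin p) × ℝ)) [IsProbabilityMeasure P]
    (f : EuclideanSpace ℝ (Fin p) → ℝ) (σ : ℝ) (hP : IsRegressionModel P f σ)
    (S : Matrix (Fin p) (Fin p) ℝ) (hS : S.PosSemidef) (hSinv : IsUnit S)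
    (hQ : P.map Prod.fst = multivariateGaussian 0 S)
    (x : Fin n → Ω → EuclideanSpace ℝ (Fin p)) (y : Fin n → Ω → ℝ)
    (x₀ : Ω → EuclideanSpace ℝ (Fin p)) (y₀ : Ω → ℝ)
    (hlaw : ∀ i, HasLaw (fun ω => (x i ω, y i ω)) P μ)
    (hindep : iIndepFun (fun i ω => (x i ω, y i ω)) μ)
    (hlaw₀ : HasLaw (fun ω => (x₀ ω, y₀ ω)) P μ)
    (hindep₀ : IndepFun (fun ω i => (x i ω, y i ω)) (fun ω => (x₀ ω, y₀ ω)) μ)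
    (fhat : (Fin n → EuclideanSpace ℝ (Fin p)) → (Fin n → ℝ) → EuclideanSpace ℝ (Fin p) → ℝ)
    (hfhat : IsLeastSquares fhat) :
    randomXVariance μ fhat x y x₀ ≠ ∞ ∧
    sameXVariance (Nat.zero_lt_of_lt hpn) μ fhat x y ≠ ∞ ∧
    excessVariance (Nat.zero_lt_of_lt hpn) μ fhat x y x₀ =
      σ ^ 2 * p / n * ((p + 1) / ((n : ℝ) - p - 1)) := by
  have hf := hP.measurable_f
  have hm : Measurable fun z : EuclideanSpace ℝ (Fin p) × ℝ => z.2 - f z.1 := by fun_prop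
  obtain ⟨hν, hσ⟩ := hP.memLp_error_and_variance_error
  have h1 := hP.hasLaw_covariates_error hlaw hindep
  have h0 := hP.hasLaw_covariates_newCovariate_error hlaw hindep hlaw₀ hindep₀
  set ν := P.map fun z => z.2 - f z.1
  have : IsProbabilityMeasure ν := Measure.isProbabilityMeasure_map hm.aemeasurable
  rw [hQ] at h0 h1
  have hdet := ae_det_scatterMatrix_ne_zero hpn hS hSinv
  have hdetΩ : ∀ᵐ ω ∂μ, (scatterMatrix fun i => x i ω).det ≠ 0 := by
    have h := Measure.quasiMeasurePreserving_fst (μ := Measure.pi fun _ : Fin n =>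
      multivariateGaussian (0 : EuclideanSpace ℝ (Fin p)) S)
      (ν := Measure.pi fun _ : Fin n => ν) |>.ae hdet
    rw [← h1.map_eq] at h
    exact ae_of_ae_map h1.aemeasurable h
  -- The first sum depends on the covariates only and plays the role of `c` in
  -- `integratedCondVar_affine`. Leaving `v` arbitrary serves both `x₀` and the first training
  -- covariate.
  have hpred : ∀ v : Ω → EuclideanSpace ℝ (Fin p), ∀ᵐ ω ∂μ,
      fhat (fun i => x i ω) (fun i => y i ω) (v ω) =
        ∑ i, leastSquaresWeight (fun i => x i ω) (v ω) i * f (x i ω) +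
        ∑ i, leastSquaresWeight (fun i => x i ω) (v ω) i * (y i ω - f (x i ω)) := by
    intro v
    filter_upwards [hdetΩ] with ω hω
    rw [hfhat.eq_leastSquaresWeight_dotProduct hω, dotProduct, ← Finset.sum_add_distrib]
    exact Finset.sum_congr rfl fun i _ => by ring
  have hn : (0 : ℝ) < n := by exact_mod_cast Nat.zero_lt_of_lt hpn
  have hpn' : (0 : ℝ) < (n : ℝ) - p - 1 := by
    have : (p : ℝ) + 1 < n := by exact_mod_cast hpn
    linarith
  have hrandom : randomXVariance μ fhat x y x₀ =
      ENNReal.ofReal (σ ^ 2 * (p / ((n : ℝ) - p - 1))) := by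
    rw [randomXVariance, integratedCondVar_affine hν h0 (a := fun w => leastSquaresWeight w.1 w.2)
      measurable_leastSquaresWeight
      (c := fun w => ∑ i, leastSquaresWeight w.1 w.2 i * f (w.1 i)) ?_ (hpred x₀), hσ]
    · rw [ENNReal.ofReal_mul (sq_nonneg σ), ← lintegral_leverage_multivariateGaussian hpn hS hSinv,
        ← lintegral_const_mul _ measurable_leverage.ennreal_ofReal]
      refine lintegral_congr_ae ?_
      filter_upwards [Measure.quasiMeasurePreserving_fst.ae hdet] with w hw
      rw [← Finset.sum_mul, sum_sq_leastSquaresWeight hw, mul_comm,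
        ENNReal.ofReal_mul (sq_nonneg σ)]
    · have := measurable_leastSquaresWeight (n := n) (p := p)
      fun_prop
  have hsame : sameXVariance (Nat.zero_lt_of_lt hpn) μ fhat x y =
      ENNReal.ofReal (σ ^ 2 * (p / n)) := by
    set k : Fin n := ⟨0, Nat.zero_lt_of_lt hpn⟩
    have hmk : Measurable fun w : Fin n → EuclideanSpace ℝ (Fin p) => (w, w k) := by fun_prop
    have hweight : Measurable fun w : Fin n → EuclideanSpace ℝ (Fin p) =>
      leastSquaresWeight w (w k) := measurable_leastSquaresWeight.comp hmk
    have hlev : Measurable fun w : Fin n → EuclideanSpace ℝ (Fin p) =>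
      ENNReal.ofReal (leverage w (w k)) := (measurable_leverage.comp hmk).ennreal_ofReal
    rw [sameXVariance, integratedCondVar_affine hν h1 (a := fun w => leastSquaresWeight w (w k))
      hweight (c := fun w => ∑ i, leastSquaresWeight w (w k) i * f (w i)) (by fun_prop)
      (hpred (x k)), hσ]
    rw [ENNReal.ofReal_mul (sq_nonneg σ), ← lintegral_leverage_self hdet k,
      ← lintegral_const_mul _ hlev]
    refine lintegral_congr_ae ?_
    filter_upwards [hdet] with w hw
    rw [← Finset.sum_mul, sum_sq_leastSquaresWeight hw, mul_comm,
      ENNReal.ofReal_mul (sq_nonneg σ)]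
  refine ⟨hrandom ▸ ENNReal.ofReal_ne_top, hsame ▸ ENNReal.ofReal_ne_top, ?_⟩
  rw [excessVariance, hrandom, hsame, ENNReal.toReal_ofReal (by positivity),
    ENNReal.toReal_ofReal (by positivity)]
  -- What remains is `σ²` times `p / (n - p - 1) - p / n`.
  field_simp
  ring
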